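/- Model. Let $g:\mathbb{N}\to[0,1]$ be non-increasing with $0<g(0)<1$ ($g(r)$ is the error probability after $r$ retransmissions), and let $r_{max}\in\{0,1,2,\ldots\}\cup\{\infty\}$ be such that $g(r)>0$ for all $r<r_{max}$. The states are $\mathcal{S}=\{(\delta,r)\in\mathbb{N}^2: r<\min\{\delta,r_{max}+1\}\}$ and the actions are $\mathrm{i}$ (idle), $\mathrm{n}$ (new update), $\mathrm{x}$ (retransmit), where $\mathrm{x}$ is not allowed in states $(\delta,0)$. From $(\delta,r)$: action $\mathrm{i}$ leads to $(\delta+1,0)$; action $\mathrm{n}$ leads to $(\delta+1,\min\{1,r_{max}\})$ with probability $g(0)$ and to $(1,0)$ with probability $1-g(0)$; action $\mathrm{x}$ leads to $(\delta+1,\min\{r+1,r_{max}\})$ with probability $g(r)$ and to $(r+1,0)$ with probability $1-g(r)$. The costs are $c((\delta,r),a)=\delta$ and $d(s,a)=\mathbb{1}[a\ne\mathrm{i}]$. A policy is any randomized history-dependent rule choosing allowed actions; a deterministic policy is a function assigning to every state an allowed action. For a policy $\pi$ let $$J^\pi(s)=\limsup_{T\to\infty}\frac1T\,\mathbb{E}^\pi\Big[\sum_{t=1}^T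 c(s_t,a_t)\,\Big|\,s_0=s\Big],\qquad C^\pi(s)=\limsup_{T\to\infty}\frac1T\,\mathbb{E}^\pi\Big[\sum_{t=1}^T d(s_t,a_t)\,\Big|\,s_0=s\Big],$$ and write $J^\pi=J^\pi((1,0))$, $C^\pi=C^\pi((1,0))$. For $G\subset\mathcal{S}$ let $\tau_G=\inf\{t\ge1:s_t\in G\}$, and let $\mathcal{R}^*(s,G)$ be the set of policies under which, started from $s_0=s$, one has $\tau_G<\infty$ almost surely, $\mathbb{E}[\tau_G]<\infty$, $\mathbb{E}\big[\sum_{t=0}^{\tau_G-1}c(s_t,a_t)\big]<\infty$ and $\mathbb{E}\big[\sum_{t=0}^{\tau_G-1}d(s_t,a_t)\big]<\infty$. For the Markov chain induced by a deterministic policy, a state $s$ is positive recurrent if $\mathbb{E}[\tau_{\{s\}}\mid s_0=s]<\infty$ and transient if $\Pr(\tau_{\{s\}}<\infty\mid s_0=s)<1$; a positive recurrent class is a communication class (equivalence class of mutual reachability) all of whose states are positive recurrent. Proposition. Let $C_{max}\in(0,1]$. Then the following hold (Assumptions 1–5 of Sennott (1993)). (i) For all $b>0$, the set of states $s$ for which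 there is an allowed action $a$ with $c(s,a)+d(s,a)\le b$ is finite. (ii) There exists a deterministic policy $\pi$ such that $\mathcal{S}$ is the disjoint union of a single (nonempty) positive recurrent class $R$ of the induced chain and a (possibly empty) set $U$ of transient states, with $\pi\in\mathcal{R}^*(s,R)$ for every $s\in U$, and $J^\pi(s)<\infty$ and $C^\pi(s)<\infty$ for every $s\in R$. (iii) For any two states $s,s'\in\mathcal{S}$ there exists a policy $\pi\in\mathcal{R}^*(s,\{s'\})$. (iv) If a deterministic policy has at least one positive recurrent state, then it has exactly one positive recurrent class, and this class contains $(1,0)$. (v) There exists a policy $\pi$ with $J^\pi<\infty$ and $C^\pi<C_{max}$. -/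

import Mathlib

open MeasureTheory ProbabilityTheory Filter
open scoped ENNReal NNReal

noncomputable section

namespace AoI

/-- A HARQ channel: `g r` is the probability of error after `r` retransmissions and `rmax` is the
maximum number of retransmissions, possibly infinite. The last field says that `rmax` does not
exceed the smallest `r` with `g r = 0` (if there is one). -/
structure Channel where
  g : ℕ → ℝ≥0
  rmax : ℕ∞
  g_antitone : Antitone g
  g_zero_pos : 0 < g 0
  g_zero_lt_one : g 0 < 1
  g_pos_of_lt : ∀ r : ℕ, (r : ℕ∞) < rmax → 0 < g r

/-- The three actions: remain idle, send a new update, retransmit the failed update. -/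
inductive Act where
  | idle
  | new
  | retx
  deriving DecidableEq

instance : Fintype Act := ⟨{Act.idle, Act.new, Act.retx}, fun a => by cases a <;> simp⟩

instance : MeasurableSpace Act := ⊤

instance : DiscreteMeasurableSpace Act := ⟨fun _ => trivial⟩

/-- States `(δ, r)` with `r < min {δ, rmax + 1}`; in particular `1 ≤ δ`. -/
abbrev State (M : Channel) : Type := {p : ℕ × ℕ // p.2 < p.1 ∧ (p.2 : ℕ∞) ≤ M.rmax}

/-- The age `δ` of the state `(δ, r)`. -/
def State.age {M : Channel} (s : State M) : ℕ := s.1.1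

/-- The number `r` of previous transmission attempts in the state `(δ, r)`. -/
def State.att {M : Channel} (s : State M) : ℕ := s.1.2

/-- The state `(δ, 0)`, where `0 < δ`. -/
def freshState (M : Channel) (δ : ℕ) (h : 0 < δ) : State M := ⟨(δ, 0), h, by simp⟩

/-- The state `(1, 0)`. -/
def startState (M : Channel) : State M := freshState M 1 one_pos

/-- The state entered from age `δ` when the packet transmitted has had `k` earlier attempts and
fails again: `(δ + 1, k + 1)`, with the attempt count truncated at `rmax`. -/
def failState (M : Channel) (δ k : ℕ) (h : k < δ) (hk : (k : ℕ∞) ≤ M.rmax) : State M :=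
  ⟨(δ + 1, if ((k + 1 : ℕ) : ℕ∞) ≤ M.rmax then k + 1 else k), by
    split_ifs with h'
    · exact ⟨by simpa using h, h'⟩
    · exact ⟨by simpa using Nat.lt_succ_of_lt h, hk⟩⟩

/-- A retransmission is not allowed in states whose transmission count is `0`. -/
def Admissible {M : Channel} (s : State M) (a : Act) : Prop := a = Act.retx → 0 < s.att

/-- The law of the next state: with probability `g k` the transmission fails. -/
def step {M : Channel} (s : State M) : Act → Measure (State M)
  | .idle => Measure.dirac (freshState M (s.age + 1) (Nat.succ_pos _))
  | .new =>
      M.g 0 • Measure.dirac (failState M s.age 0 (Nat.zero_lt_of_lt s.2.1) (by simp))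
        + (1 - M.g 0) • Measure.dirac (startState M)
  | .retx =>
      M.g s.att • Measure.dirac (failState M s.age s.att s.2.1 s.2.2)
        + (1 - M.g s.att) • Measure.dirac (freshState M (s.att + 1) (Nat.succ_pos _))

theorem Channel.g_le_one (M : Channel) (r : ℕ) : M.g r ≤ 1 :=
  (M.g_antitone (Nat.zero_le r)).trans M.g_zero_lt_one.le

theorem mix_isProbabilityMeasure {α : Type*} [MeasurableSpace α] (p : ℝ≥0) (hp : p ≤ 1) (x y : α) :
    IsProbabilityMeasure (p • Measure.dirac x + (1 - p) • Measure.dirac y) := by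
  constructor
  simp only [Measure.add_apply, Measure.smul_apply, measure_univ, ENNReal.smul_def, smul_eq_mul,
    mul_one]
  rw [← ENNReal.coe_add, add_tsub_cancel_of_le hp, ENNReal.coe_one]

instance {M : Channel} (s : State M) (a : Act) : IsProbabilityMeasure (step s a) := by
  cases a
  · exact Measure.dirac.isProbabilityMeasure
  · exact mix_isProbabilityMeasure _ (M.g_le_one _) _ _
  · exact mix_isProbabilityMeasure _ (M.g_le_one _) _ _

/-- The age cost `c`. -/
def ageCost {M : Channel} (s : State M) (_ : Act) : ℝ≥0 := s.age

/-- The transmission cost `d`. -/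
def txCost {M : Channel} (_ : State M) (a : Act) : ℝ≥0 := if a = Act.idle then 0 else 1

/-- A (randomized, history-dependent) policy: from `(s₀, a₀), …, (sₜ₋₁, aₜ₋₁)` and the current
state `sₜ` it gives a distribution on the admissible actions. -/
structure Policy (M : Channel) where
  rule : (t : ℕ) → (Fin t → State M × Act) → State M → PMF Act
  admissible : ∀ t h s, ∀ a ∈ (rule t h s).support, Admissible s a

/-- A stationary deterministic policy. -/
structure DetPolicy (M : Channel) where
  act : State M → Act
  admissible : ∀ s, Admissible s (act s)

/-- A deterministic policy as a policy. -/
def DetPolicy.toPolicy {M : Channel} (f : DetPolicy M) : Policy M where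
  rule _ _ s := PMF.pure (f.act s)
  admissible _ _ s a ha := by
    have h : a = f.act s := by simpa using ha
    exact h ▸ f.admissible s

namespace Policy

variable {M : Channel}

/-- The law of the action at time `t`, as a kernel in the current state, given the past `h`. -/
def actionKernel (π : Policy M) (t : ℕ) (h : Fin t → State M × Act) : Kernel (State M) Act :=
  Kernel.ofFunOfCountable fun s => (π.rule t h s).toMeasure

instance (π : Policy M) (t : ℕ) (h : Fin t → State M × Act) :
    IsMarkovKernel (π.actionKernel t h) :=
  ⟨fun s => PMF.toMeasure.isProbabilityMeasure (π.rule t h s)⟩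

/-- The law of `(sₜ₊₁, aₜ₊₁)` given `(s₀, a₀), …, (sₜ, aₜ)`. -/
def stepKernel (π : Policy M) (t : ℕ) :
    Kernel ((_ : Finset.Iic t) → State M × Act) (State M × Act) :=
  Kernel.ofFunOfCountable fun h =>
    step (h ⟨t, Finset.mem_Iic.2 le_rfl⟩).1 (h ⟨t, Finset.mem_Iic.2 le_rfl⟩).2 ⊗ₘ
      π.actionKernel (t + 1) (fun i => h ⟨i, Finset.mem_Iic.2 (Nat.le_of_lt_succ i.2)⟩)

instance (π : Policy M) (t : ℕ) : IsMarkovKernel (π.stepKernel t) :=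
  ⟨fun h => by
    change IsProbabilityMeasure (_ ⊗ₘ _)
    infer_instance⟩

/-- The law of the state-action sequence `(s₀, a₀), (s₁, a₁), …` under `π` with `s₀ = s`. -/
def law (π : Policy M) (s : State M) : Measure (ℕ → State M × Act) :=
  Kernel.trajMeasure (X := fun _ => State M × Act)
    (Measure.dirac s ⊗ₘ π.actionKernel 0 Fin.elim0) π.stepKernel

/-- Long-run average of the expected cost `k`, from `s`. -/
def avgCost (π : Policy M) (s : State M) (k : State M → Act → ℝ≥0) : ℝ≥0∞ :=
  limsup (fun T : ℕ =>
    (∫⁻ ω, ∑ t ∈ Finset.Icc 1 T, (k (ω t).1 (ω t).2 : ℝ≥0∞) ∂π.law s) / (T : ℝ≥0∞)) atTop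

/-- The average AoI `J`. -/
def J (π : Policy M) (s : State M) : ℝ≥0∞ := π.avgCost s ageCost

/-- The average transmission cost `C`. -/
def C (π : Policy M) (s : State M) : ℝ≥0∞ := π.avgCost s txCost

end Policy

/-- The first time `t ≥ 1` at which the path is in `G` (`⊤` if there is none). -/
def passageTime {M : Channel} (G : Set (State M)) (ω : ℕ → State M × Act) : ℕ∞ :=
  ⨅ (t : ℕ) (_ : 1 ≤ t ∧ (ω t).1 ∈ G), (t : ℕ∞)

namespace Policy

variable {M : Channel}

/-- The probability of being in `G` at some time `t ≥ 1`. -/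
def passageProb (π : Policy M) (s : State M) (G : Set (State M)) : ℝ≥0∞ :=
  π.law s {ω | ∃ t, 1 ≤ t ∧ (ω t).1 ∈ G}

/-- The expected first passage time from `s` to `G`. -/
def expPassageTime (π : Policy M) (s : State M) (G : Set (State M)) : ℝ≥0∞ :=
  ∫⁻ ω, (passageTime G ω : ℝ≥0∞) ∂π.law s

/-- The expected total cost `k` of a first passage from `s` to `G`. -/
def expPassageCost (π : Policy M) (s : State M) (G : Set (State M))
    (k : State M → Act → ℝ≥0) : ℝ≥0∞ :=
  ∫⁻ ω, ∑' t : ℕ, {t : ℕ | (t : ℕ∞) < passageTime G ω}.indicator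
    (fun t => (k (ω t).1 (ω t).2 : ℝ≥0∞)) t ∂π.law s

end Policy

/-- The class `𝓡(s, G)`. -/
def passageClass {M : Channel} (s : State M) (G : Set (State M)) : Set (Policy M) :=
  {π | π.passageProb s G = 1 ∧ π.expPassageTime s G < ∞}

/-- The class `𝓡*(s, G)`. -/
def passageClassStar {M : Channel} (s : State M) (G : Set (State M)) : Set (Policy M) :=
  {π | π ∈ passageClass s G ∧ π.expPassageCost s G ageCost < ∞ ∧
    π.expPassageCost s G txCost < ∞}

namespace DetPolicy

variable {M : Channel}

/-- Positive recurrence of `s` for the Markov chain induced by `f`: finite expected return time. -/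
def PosRecurrent (f : DetPolicy M) (s : State M) : Prop :=
  f.toPolicy.expPassageTime s {s} < ∞

/-- Transience of `s` for the Markov chain induced by `f`. -/
def IsTransient (f : DetPolicy M) (s : State M) : Prop :=
  f.toPolicy.passageProb s {s} < 1

/-- The chain started in `s` reaches `s'` with positive probability. -/
def Reaches (f : DetPolicy M) (s s' : State M) : Prop :=
  0 < f.toPolicy.law s {ω | ∃ t, (ω t).1 = s'}

/-- `R` is a communication class, that is, a class of the relation of mutual reachability. -/
def IsCommClass (f : DetPolicy M) (R : Set (State M)) : Prop :=
  ∃ s, R = {s' | f.Reaches s s' ∧ f.Reaches s' s}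

/-- `R` is a positive recurrent communication class. -/
def IsPosRecurrentClass (f : DetPolicy M) (R : Set (State M)) : Prop :=
  f.IsCommClass R ∧ ∀ s ∈ R, f.PosRecurrent s

end DetPolicy

end AoI

end

/-! Every policy needed is stationary, so its law enters only through iterates of the one-step
operator killed on entering `G` (`lintegral_law_avoid`). Passage times and costs become the
potential `green`, the sum of these iterates, which satisfies `green_eq` and is bounded by any
function with suitable drift.

The drift comes from one fact: age grows by at most one per step, so if every state jumps to `(1,
0)` with probability at least `e > 0`, a linear function of age is a Lyapunov function. This gives
finite passage costs to `(1, 0)` (`green_start_lt_top`) and finite average age (`J_lt_top`). Sending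
a new update with probability bounded below guarantees such an `e`, since it succeeds with
probability `1 - g 0 > 0`. Always sending gives (ii), choosing uniformly among allowed actions gives
(iii), and sending with probability `Cmax / 2` gives (v).

For (iii), every state can be reached from `(1, 0)` under the uniform rule, and a finite return cost
to a state yields a finite passage cost to every state reachable from it (`green_lt_top_of_return`).

For (iv), a state can be revisited only if a new update is sent on the way, and that update may
succeed. Hence every positive recurrent state leads to `(1, 0)`, and positive recurrence spreads
along reachability, so all such states share its class. Part (i) holds because cost bounds age and
age bounds the attempt count. -/

noncomputable section

namespace AoI

variable {M : Channel}

/-- The stationary policy that draws the action in state `s` from `q s`. -/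
def Policy.stationary (q : State M → PMF Act) (hq : ∀ s, ∀ a ∈ (q s).support, Admissible s a) :
    Policy M where
  rule _ _ s := q s
  admissible _ _ s a ha := hq s a ha

/-- The transition law of the state under a stationary policy. -/
def trans (q : State M → PMF Act) (s : State M) : Measure (State M) :=
  ∑ a, q s a • step s a

/-- The expected value of `k` in state `s` when the action is drawn from `q s`. -/
def actMean (q : State M → PMF Act) (k : State M × Act → ℝ≥0∞) (s : State M) : ℝ≥0∞ :=
  ∑ a, q s a * k (s, a)

/-- One step of the chain with transition laws `P`, killed on entering `G`. -/
def killed {S : Type*} [MeasurableSpace S] (P : S → Measure S) (G : Set S) (f : S → ℝ≥0∞) (x : S) :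
    ℝ≥0∞ :=
  ∫⁻ y, Gᶜ.indicator f y ∂P x

theorem lintegral_trans (q : State M → PMF Act) (s : State M) (f : State M → ℝ≥0∞) :
    ∫⁻ x, f x ∂trans q s = ∑ a, q s a * ∫⁻ x, f x ∂step s a := by
  simp [trans, lintegral_finsetSum_measure, lintegral_smul_measure]

theorem PMF_sum_eq_one (p : PMF Act) : ∑ a, p a = 1 := by
  rw [← tsum_fintype (L := .unconditional _), p.tsum_coe]

instance (q : State M → PMF Act) (s : State M) : IsProbabilityMeasure (trans q s) := by
  constructor
  rw [← lintegral_one, lintegral_trans]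
  simp [PMF_sum_eq_one]

theorem lintegral_PMF (p : PMF Act) (f : Act → ℝ≥0∞) : ∫⁻ a, f a ∂p.toMeasure = ∑ a, p a * f a := by
  rw [lintegral_fintype]
  refine Finset.sum_congr rfl fun a _ => ?_
  rw [PMF.toMeasure_apply_singleton _ _ (measurableSet_singleton a), mul_comm]

/-! ### Path laws of stationary policies as iterates of the killed operator -/

section law

variable {q : State M → PMF Act} {hq : ∀ s, ∀ a ∈ (q s).support, Admissible s a}

theorem lintegral_actionKernel (t : ℕ) (h : Fin t → State M × Act) (s : State M)
    (f : Act → ℝ≥0∞) :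
    ∫⁻ a, f a ∂(Policy.stationary q hq).actionKernel t h s = ∑ a, q s a * f a :=
  lintegral_PMF _ _

theorem lintegral_law_zero (s : State M) (f : State M × Act → ℝ≥0∞) :
    ∫⁻ ω, f (ω 0) ∂(Policy.stationary q hq).law s = actMean q f s := by
  have h0 : ((Policy.stationary q hq).law s).map (fun ω => ω 0)
      = Measure.dirac s ⊗ₘ (Policy.stationary q hq).actionKernel 0 Fin.elim0 := by
    have : (fun ω : ℕ → State M × Act => ω 0) =
      (MeasurableEquiv.piUnique (fun _ : Finset.Iic 0 => State M × Act)) ∘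
        (Preorder.frestrictLe 0) := rfl
    rw [this, ← Measure.map_map (by fun_prop) (by fun_prop), Policy.law, Kernel.trajMeasure,
      Measure.map_comp _ _ (by fun_prop), Kernel.traj_map_frestrictLe, Kernel.partialTraj_self,
      Measure.id_comp, Measure.map_map (by fun_prop) (by fun_prop)]
    simp only [MeasurableEquiv.self_comp_symm, Measure.map_id]
  rw [← lintegral_map (f := f) (g := fun ω : ℕ → State M × Act => ω 0) (by fun_prop) (by fun_prop),
    h0, Measure.lintegral_compProd (by fun_prop), lintegral_dirac]
  exact lintegral_actionKernel _ _ _ _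

/-- The Markov property at time `t`. The factor `F` of the past leaves room for the indicator of
having avoided `G` so far. -/
theorem lintegral_law_succ (s : State M) (t : ℕ)
    (F : ((_ : Finset.Iic t) → State M × Act) → ℝ≥0∞) (f : State M × Act → ℝ≥0∞) :
    ∫⁻ ω, F (Preorder.frestrictLe t ω) * f (ω (t + 1)) ∂(Policy.stationary q hq).law s =
      ∫⁻ ω, F (Preorder.frestrictLe t ω) * (∫⁻ x, actMean q f x ∂step (ω t).1 (ω t).2)
        ∂(Policy.stationary q hq).law s := by
  have key := Kernel.map_frestrictLe_trajMeasure_compProd_eq_map_trajMeasure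
    (X := fun _ => State M × Act)
    (μ₀ := Measure.dirac s ⊗ₘ (Policy.stationary q hq).actionKernel 0 Fin.elim0)
    (κ := (Policy.stationary q hq).stepKernel) (a := t)
  have hF : Measurable F := measurable_of_countable F
  have hf : Measurable f := measurable_of_countable f
  change Measure.map _ ((Policy.stationary q hq).law s) ⊗ₘ _ =
    Measure.map _ ((Policy.stationary q hq).law s) at key
  have hm : Measurable fun p : ((_ : Finset.Iic t) → State M × Act) × (State M × Act) =>
    F p.1 * f p.2 := by fun_prop
  have e1 : ∫⁻ ω, F (Preorder.frestrictLe t ω) * f (ω (t + 1)) ∂(Policy.stationary q hq).law s =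
      ∫⁻ p, F p.1 * f p.2 ∂Measure.map
        (fun x : ℕ → State M × Act => (Preorder.frestrictLe t x, x (t + 1)))
        ((Policy.stationary q hq).law s) := by
    rw [lintegral_map hm (by fun_prop)]
  rw [e1, ← key, Measure.lintegral_compProd hm,
    lintegral_map (measurable_of_countable _) (by fun_prop)]
  refine lintegral_congr fun ω => ?_
  simp only
  rw [lintegral_const_mul _ hf]
  congr 1
  change ∫⁻ p, f p ∂(_ ⊗ₘ _) = _
  rw [Measure.lintegral_compProd hf]
  refine lintegral_congr fun x => ?_
  exact lintegral_actionKernel _ _ _ _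

theorem lintegral_actMean_step (k : State M × Act → ℝ≥0∞) (s : State M) :
    actMean q (fun p => ∫⁻ x, actMean q k x ∂step p.1 p.2) s = ∫⁻ x, actMean q k x ∂trans q s := by
  rw [lintegral_trans]; rfl

/-- The paths that are not in `G` at the times `1, …, t`. -/
def avoiding (G : Set (State M)) (t : ℕ) : Set (ℕ → State M × Act) :=
  {ω | ∀ u, 1 ≤ u → u ≤ t → (ω u).1 ∉ G}

theorem mem_avoiding_zero (G : Set (State M)) (ω : ℕ → State M × Act) : ω ∈ avoiding G 0 :=
  fun u h1 h2 => absurd h1 (by omega)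

theorem mem_avoiding_empty (t : ℕ) (ω : ℕ → State M × Act) : ω ∈ avoiding ∅ t :=
  fun _ _ _ => id

theorem mem_avoiding_succ (G : Set (State M)) (t : ℕ) (ω : ℕ → State M × Act) :
    ω ∈ avoiding G (t + 1) ↔ ω ∈ avoiding G t ∧ (ω (t + 1)).1 ∉ G := by
  constructor
  · exact fun h => ⟨fun u h1 h2 => h u h1 (h2.trans t.le_succ), h _ t.succ_pos le_rfl⟩
  · rintro ⟨h, hG⟩ u h1 h2
    rcases h2.lt_or_eq with h' | rfl
    · exact h u h1 (Nat.le_of_lt_succ h')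
    · exact hG

theorem actMean_indicator (G : Set (State M)) (k : State M × Act → ℝ≥0∞) :
    actMean q (fun p => Gᶜ.indicator 1 p.1 * k p) = Gᶜ.indicator (actMean q k) := by
  ext x
  by_cases hx : x ∈ G <;> simp [actMean, hx]

theorem actMean_step_indicator (G : Set (State M)) (k : State M × Act → ℝ≥0∞) :
    (actMean q fun p => ∫⁻ x, Gᶜ.indicator (actMean q k) x ∂step p.1 p.2) =
      killed (trans q) G (actMean q k) := by
  ext x
  rw [← actMean_indicator, lintegral_actMean_step, actMean_indicator]
  rfl

theorem indicator_frestrictLe (G : Set (State M)) (t : ℕ) (ω : ℕ → State M × Act) (c : ℝ≥0∞) :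
    {h : (_ : Finset.Iic t) → State M × Act | ∀ u : Finset.Iic t, 1 ≤ u.1 →
      (h u).1 ∉ G}.indicator (fun _ => 1) (Preorder.frestrictLe t ω) * c =
    (avoiding G t).indicator (fun _ => c) ω := by
  by_cases hA : ω ∈ avoiding G t
  · rw [Set.indicator_of_mem hA, Set.indicator_of_mem, one_mul]
    exact fun u h => hA u h (Finset.mem_Iic.1 u.2)
  · rw [Set.indicator_of_notMem hA, Set.indicator_of_notMem, zero_mul]
    exact fun h => hA fun u h1 h2 => h ⟨u, Finset.mem_Iic.2 h2⟩ h1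

theorem indicator_avoiding_succ (G : Set (State M)) (t : ℕ) (ω : ℕ → State M × Act) (c : ℝ≥0∞) :
    (avoiding G (t + 1)).indicator (fun _ => c) ω =
      (avoiding G t).indicator (fun _ => Gᶜ.indicator 1 (ω (t + 1)).1 * c) ω := by
  by_cases hA : ω ∈ avoiding G t
  · rw [Set.indicator_of_mem hA]
    by_cases hG : (ω (t + 1)).1 ∈ G
    · rw [Set.indicator_of_notMem (fun h => ((mem_avoiding_succ G t ω).1 h).2 hG)]
      simp [hG]
    · rw [Set.indicator_of_mem ((mem_avoiding_succ G t ω).2 ⟨hA, hG⟩)]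
      simp [hG]
  · rw [Set.indicator_of_notMem hA,
      Set.indicator_of_notMem (fun h => hA ((mem_avoiding_succ G t ω).1 h).1)]

theorem lintegral_law_avoid_succ (s : State M) (G : Set (State M)) (t : ℕ)
    (k : State M × Act → ℝ≥0∞) :
    ∫⁻ ω, (avoiding G (t + 1)).indicator (fun _ => k (ω (t + 1))) ω
        ∂(Policy.stationary q hq).law s =
      ∫⁻ ω, (avoiding G t).indicator (fun _ =>
        ∫⁻ x, Gᶜ.indicator (actMean q k) x ∂step (ω t).1 (ω t).2) ω
        ∂(Policy.stationary q hq).law s := by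
  have h1 := lintegral_law_succ (hq := hq) s t
    ({h | ∀ u : Finset.Iic t, 1 ≤ u.1 → (h u).1 ∉ G}.indicator fun _ => 1)
    (fun p => Gᶜ.indicator 1 p.1 * k p)
  simp only [indicator_frestrictLe, actMean_indicator] at h1
  simp only [indicator_avoiding_succ]
  exact h1

/-- The expected value of `k` at time `t` on the event that `G` is avoided at times `1, …, t`. -/
theorem lintegral_law_avoid (s : State M) (G : Set (State M)) (t : ℕ)
    (k : State M × Act → ℝ≥0∞) :
    ∫⁻ ω, (avoiding G t).indicator (fun _ => k (ω t)) ω ∂(Policy.stationary q hq).law s =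
      (killed (trans q) G)^[t] (actMean q k) s := by
  induction t generalizing k with
  | zero =>
    rw [Function.iterate_zero, id, ← lintegral_law_zero (hq := hq)]
    exact lintegral_congr fun ω => Set.indicator_of_mem (mem_avoiding_zero G ω) _
  | succ t ih =>
    -- The last transition is absorbed into a new cost at time `t`, which is why the induction is
    -- over all `k`.
    rw [lintegral_law_avoid_succ, Function.iterate_succ_apply, ← actMean_step_indicator]
    exact ih fun p => ∫⁻ x, Gᶜ.indicator (actMean q k) x ∂step p.1 p.2

theorem lintegral_law (s : State M) (t : ℕ) (k : State M × Act → ℝ≥0∞) :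
    ∫⁻ ω, k (ω t) ∂(Policy.stationary q hq).law s = (killed (trans q) ∅)^[t] (actMean q k) s := by
  rw [← lintegral_law_avoid]
  exact lintegral_congr fun ω => (Set.indicator_of_mem (mem_avoiding_empty t ω) fun _ => k (ω t)).symm

theorem actMean_of_fst (f : State M → ℝ≥0∞) : actMean q (fun p => f p.1) = f := by
  ext s
  simp only [actMean]
  rw [← Finset.sum_mul, PMF_sum_eq_one, one_mul]

instance (π : Policy M) (s : State M) : IsProbabilityMeasure (π.law s) := by
  unfold Policy.law
  infer_instance

theorem lt_passageTime_iff (G : Set (State M)) (t : ℕ) (ω : ℕ → State M × Act) :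
    (t : ℕ∞) < passageTime G ω ↔ ω ∈ avoiding G t := by
  constructor
  · intro h u h1 h2 h3
    exact absurd h (not_lt.2 ((iInf₂_le u ⟨h1, h3⟩).trans (by exact_mod_cast h2)))
  · intro h
    refine lt_of_lt_of_le (b := ((t + 1 : ℕ) : ℕ∞)) (by exact_mod_cast t.lt_succ_self) ?_
    refine le_iInf₂ fun u hu => ?_
    by_contra hlt
    exact h u hu.1 (by have : u < t + 1 := by exact_mod_cast not_le.1 hlt
                       omega) hu.2

theorem measurableSet_avoiding (G : Set (State M)) (t : ℕ) : MeasurableSet (avoiding G t) := by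
  have : avoiding G t = ⋂ (u : ℕ) (_ : 1 ≤ u) (_ : u ≤ t),
      (fun ω : ℕ → State M × Act => (ω u).1) ⁻¹' Gᶜ := by
    ext ω; simp [avoiding]
  rw [this]
  refine .iInter fun u => .iInter fun _ => .iInter fun _ => ?_
  exact (MeasurableSet.of_discrete (s := Gᶜ)).preimage (by fun_prop)

/-- Makes the expected passage time the passage cost for unit cost. -/
theorem coe_enat_eq_tsum (n : ℕ∞) :
    (n : ℝ≥0∞) = ∑' t : ℕ, {t : ℕ | (t : ℕ∞) < n}.indicator (fun _ => 1) t := by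
  induction n using ENat.recTopCoe with
  | top => simp
  | coe n =>
    rw [tsum_eq_sum (s := Finset.range n) (fun t ht => by simpa using ht)]
    rw [Finset.sum_congr rfl (g := fun _ => 1) (fun t ht => by simpa using ht)]
    simp

theorem expPassageCost_eq (s : State M) (G : Set (State M)) (k : State M → Act → ℝ≥0) :
    (Policy.stationary q hq).expPassageCost s G k =
      ∑' t, (killed (trans q) G)^[t] (actMean q fun p => k p.1 p.2) s := by
  rw [Policy.expPassageCost, lintegral_tsum]
  · refine tsum_congr fun t => ?_
    rw [← lintegral_law_avoid (hq := hq)]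
    refine lintegral_congr fun ω => ?_
    by_cases h : ω ∈ avoiding G t
    · simp [h, lt_passageTime_iff]
    · simp [h, lt_passageTime_iff]
  · intro t
    have : (fun ω : ℕ → State M × Act => {t : ℕ | (t : ℕ∞) < passageTime G ω}.indicator
        (fun t => (k (ω t).1 (ω t).2 : ℝ≥0∞)) t) =
        (avoiding G t).indicator (fun ω => (k (ω t).1 (ω t).2 : ℝ≥0∞)) := by
      ext ω
      by_cases h : ω ∈ avoiding G t
      · simp [h, lt_passageTime_iff]
      · simp [h, lt_passageTime_iff]
    rw [this]
    refine (Measurable.indicator ?_ (measurableSet_avoiding G t)).aemeasurable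
    exact (measurable_of_countable (fun p : State M × Act => (k p.1 p.2 : ℝ≥0∞))).comp
      (measurable_pi_apply t)

theorem expPassageTime_eq_expPassageCost (π : Policy M) (s : State M) (G : Set (State M)) :
    π.expPassageTime s G = π.expPassageCost s G fun _ _ => 1 := by
  refine lintegral_congr fun ω => ?_
  rw [coe_enat_eq_tsum]
  simp

theorem expPassageTime_eq (s : State M) (G : Set (State M)) :
    (Policy.stationary q hq).expPassageTime s G = ∑' t, (killed (trans q) G)^[t] 1 s := by
  rw [expPassageTime_eq_expPassageCost, expPassageCost_eq]
  have : actMean q (fun p => (((fun _ _ => 1 : State M → Act → ℝ≥0) p.1 p.2 : ℝ≥0) : ℝ≥0∞)) = 1 :=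
    actMean_of_fst 1
  rw [this]

theorem passageProb_eq_one {π : Policy M} {s : State M} {G : Set (State M)}
    (h : π.expPassageTime s G < ∞) : π.passageProb s G = 1 := by
  have hm : Measurable fun ω : ℕ → State M × Act => (passageTime G ω : ℝ≥0∞) := by
    have : (fun ω : ℕ → State M × Act => (passageTime G ω : ℝ≥0∞)) =
        fun ω => ∑' t : ℕ, (avoiding G t).indicator (fun _ => 1) ω := by
      ext ω
      rw [coe_enat_eq_tsum]
      refine tsum_congr fun t => ?_
      by_cases h : ω ∈ avoiding G t
      · simp [h, lt_passageTime_iff]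
      · simp [h, lt_passageTime_iff]
    rw [this]
    exact Measurable.tsum fun t => measurable_const.indicator (measurableSet_avoiding G t)
  have h1 := ae_lt_top hm h.ne
  refine le_antisymm prob_le_one ?_
  rw [← measure_univ (μ := π.law s)]
  refine measure_mono_ae (h1.mono fun ω hω _ => ?_)
  change ∃ t, 1 ≤ t ∧ (ω t).1 ∈ G
  by_contra hne
  push Not at hne
  have : passageTime G ω = ⊤ := by simpa [passageTime] using hne
  simp [this] at hω

theorem law_eq_iterate (s y : State M) (t : ℕ) :
    (Policy.stationary q hq).law s {ω | (ω t).1 = y} =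
      (killed (trans q) ∅)^[t] (({y} : Set (State M)).indicator 1) s := by
  have h := lintegral_law (hq := hq) s t (fun p => ({y} : Set (State M)).indicator 1 p.1)
  rw [actMean_of_fst] at h
  rw [← h, ← lintegral_indicator_one]
  · rfl
  · exact (MeasurableSet.of_discrete (s := ({y} : Set (State M)))).preimage
      (f := fun ω : ℕ → State M × Act => (ω t).1) (by fun_prop)

theorem avgCost_eq (s : State M) (k : State M → Act → ℝ≥0) :
    (Policy.stationary q hq).avgCost s k = limsup (fun T : ℕ =>
      (∑ t ∈ Finset.Icc 1 T, (killed (trans q) ∅)^[t] (actMean q fun p => k p.1 p.2) s)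
        / (T : ℝ≥0∞)) atTop := by
  unfold Policy.avgCost
  congr 1
  ext T
  rw [lintegral_finsetSum]
  · congr 1
    exact Finset.sum_congr rfl fun t _ =>
      lintegral_law s t (fun p : State M × Act => (k p.1 p.2 : ℝ≥0∞))
  · intro t _
    exact (measurable_of_countable (fun p : State M × Act => (k p.1 p.2 : ℝ≥0∞))).comp
      (measurable_pi_apply t)

end law

end AoI

namespace AoI

/-! ### Potential theory of killed chains -/

section chain

set_option linter.unusedSectionVars false

variable {S : Type*} [MeasurableSpace S] [DiscreteMeasurableSpace S]
  {P : S → Measure S} {G : Set S} {f f' k W : S → ℝ≥0∞}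

/-- The expected total cost `k` accumulated before the first visit to `G` at a time `t ≥ 1`. -/
def green (P : S → Measure S) (G : Set S) (k : S → ℝ≥0∞) (x : S) : ℝ≥0∞ :=
  ∑' t, (killed P G)^[t] k x

/-- The expected cost `k` accumulated before time `T` and before the first visit to `G`. -/
def greenUpTo (P : S → Measure S) (G : Set S) (k : S → ℝ≥0∞) (T : ℕ) (x : S) : ℝ≥0∞ :=
  ∑ t ∈ Finset.range T, (killed P G)^[t] k x

/-- One-step transitions of positive probability. -/
def Edge (P : S → Measure S) (x y : S) : Prop := P x {y} ≠ 0

theorem killed_mono (h : f ≤ f') : killed P G f ≤ killed P G f' :=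
  fun _ => lintegral_mono fun _ => Set.indicator_le_indicator (h _)

theorem iterate_killed_mono (h : f ≤ f') (t : ℕ) :
    (killed P G)^[t] f ≤ (killed P G)^[t] f' :=
  Monotone.iterate (fun _ _ => killed_mono) t h

theorem killed_sum {ι : Type*} (s : Finset ι) (f : ι → S → ℝ≥0∞) (x : S) :
    killed P G (fun y => ∑ i ∈ s, f i y) x = ∑ i ∈ s, killed P G (f i) x := by
  unfold killed
  rw [← lintegral_finsetSum _ fun _ _ => Measurable.of_discrete]
  refine lintegral_congr fun y => ?_
  by_cases hy : y ∈ G <;> simp [hy]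

theorem killed_tsum (f : ℕ → S → ℝ≥0∞) (x : S) :
    killed P G (fun y => ∑' i, f i y) x = ∑' i, killed P G (f i) x := by
  unfold killed
  rw [← lintegral_tsum fun _ => Measurable.of_discrete.aemeasurable]
  refine lintegral_congr fun y => ?_
  by_cases hy : y ∈ G <;> simp [hy]

theorem greenUpTo_succ (T : ℕ) (x : S) :
    greenUpTo P G k (T + 1) x = k x + killed P G (greenUpTo P G k T) x := by
  have : killed P G (greenUpTo P G k T) x = _ := killed_sum (Finset.range T) _ x
  rw [this, greenUpTo, Finset.sum_range_succ', add_comm]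
  simp only [Function.iterate_succ_apply', Function.iterate_zero, id]

theorem green_eq (x : S) : green P G k x = k x + killed P G (green P G k) x := by
  have : killed P G (green P G k) x = _ := killed_tsum _ x
  rw [this, green, tsum_eq_zero_add' ENNReal.summable]
  simp only [Function.iterate_succ_apply', Function.iterate_zero, id]

theorem green_le_of_greenUpTo_le {x : S} {c : ℝ≥0∞} (h : ∀ T, greenUpTo P G k T x ≤ c) :
    green P G k x ≤ c :=
  ENNReal.tsum_le_of_sum_range_le h

theorem greenUpTo_le_green (T : ℕ) (x : S) : greenUpTo P G k T x ≤ green P G k x :=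
  ENNReal.sum_le_tsum _

theorem greenUpTo_le_succ (T : ℕ) (x : S) :
    greenUpTo P G k T x ≤ greenUpTo P G k (T + 1) x :=
  Finset.sum_le_sum_of_subset (Finset.range_mono T.le_succ)

theorem green_mono {k' : S → ℝ≥0∞} (h : k ≤ k') (x : S) : green P G k x ≤ green P G k' x :=
  ENNReal.tsum_le_tsum fun t => iterate_killed_mono h t x

theorem green_eq_of_killed_zero {x : S} (h : P x Gᶜ = 0) : green P G k x = k x := by
  rw [green_eq, killed, lintegral_indicator (MeasurableSet.of_discrete),
    setLIntegral_measure_zero _ _ h, add_zero]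

/-- A function with drift at most `-k` off `G` bounds the expected total cost off `G`. -/
theorem green_le_of_drift (h : ∀ x ∉ G, k x + killed P G W x ≤ W x) {x : S} (hx : x ∉ G) :
    green P G k x ≤ W x := by
  refine green_le_of_greenUpTo_le fun T => ?_
  induction T generalizing x with
  | zero => simp [greenUpTo]
  | succ T ih =>
    rw [greenUpTo_succ]
    refine le_trans (add_le_add_right (lintegral_mono fun y => ?_) _) (h x hx)
    by_cases hy : y ∈ G
    · simp [hy]
    · simpa [hy] using ih hy

theorem green_le_killed_of_drift (h : ∀ x ∉ G, k x + killed P G W x ≤ W x) (x : S) :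
    green P G k x ≤ k x + killed P G W x := by
  rw [green_eq]
  refine add_le_add_right (lintegral_mono fun y => ?_) _
  by_cases hy : y ∈ G
  · simp [hy]
  · simpa [hy] using green_le_of_drift h hy

/-- By `green_eq`, the value at `x` dominates the value at `y` times the positive weight `P x {y}`.
-/
theorem green_lt_top_of_edge {x y : S} (h : green P G k x < ∞) (e : Edge P x y) (hy : y ∉ G) :
    green P G k y < ∞ := by
  rw [green_eq] at h
  have h1 := (ENNReal.add_lt_top.1 h).2
  have h2 : Gᶜ.indicator (green P G k) y * P x {y} ≤ killed P G (green P G k) x := by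
    rw [killed, ← lintegral_singleton, ← lintegral_indicator (measurableSet_singleton _)]
    exact lintegral_mono fun z => Set.indicator_le_self _ _ z
  rw [Set.indicator_of_mem (by exact hy)] at h2
  by_contra h3
  rw [not_lt, top_le_iff] at h3
  rw [h3, ENNReal.top_mul e] at h2
  exact absurd h1 (not_lt.2 h2)

theorem green_lt_top_of_reach {s x : S} (h : green P {s} k s < ∞)
    (r : Relation.ReflTransGen (Edge P) s x) : green P {s} k x < ∞ := by
  induction r with
  | refl => exact h
  | @tail y z _ e ih =>
    by_cases hz : z = s
    · rwa [hz]
    · exact green_lt_top_of_edge ih e hz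

section countable

variable [Countable S]

theorem ae_edge (x : S) : ∀ᵐ y ∂P x, Edge P x y := by
  rw [ae_iff_of_countable]
  exact fun y hy => hy

theorem measure_eq_zero_of_not_edge {x : S} {A : Set S} (h : ∀ y ∈ A, ¬ Edge P x y) :
    P x A = 0 := by
  rw [← nonpos_iff_eq_zero, ← (ae_iff.1 (ae_edge (P := P) x))]
  exact measure_mono fun y hy => h y hy

variable [∀ x, IsProbabilityMeasure (P x)]

theorem lintegral_le_of_edge {x : S} {c : ℝ≥0∞} (h : ∀ y, Edge P x y → f y ≤ c) :
    ∫⁻ y, f y ∂P x ≤ c := by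
  refine (lintegral_mono_ae ((ae_edge x).mono h)).trans ?_
  simp

/-- If the expected passage time from `x` to `s` is finite, the chain reaches `s` from `x`. -/
theorem transGen_of_green_lt_top {s x : S} (h : green P {s} 1 x < ∞) :
    Relation.TransGen (Edge P) x s := by
  by_contra hx
  -- If `s` is unreachable, no mass is ever killed, so every term of the series is `1` and the sum
  -- diverges.
  have key : ∀ t, ∀ z, ¬ Relation.TransGen (Edge P) z s → (killed P {s})^[t] 1 z = 1 := by
    intro t
    induction t with
    | zero => simp
    | succ t ih =>
      intro z hz
      rw [Function.iterate_succ', Function.comp]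
      have : killed P {s} ((killed P {s})^[t] 1) z = ∫⁻ _, 1 ∂P z := by
        refine lintegral_congr_ae ((ae_edge z).mono fun y hy => ?_)
        have hys : y ≠ s := by rintro rfl; exact hz (.single hy)
        simp only [Set.mem_compl_iff, Set.mem_singleton_iff, hys, not_false_eq_true,
          Set.indicator_of_mem]
        exact ih y fun h => hz (.head hy h)
      rw [this]; simp
  rw [green] at h
  simp [key _ x hx] at h

theorem exists_iterate_ne_zero_iff {x y : S} :
    (∃ t, (killed P ∅)^[t] (({y} : Set S).indicator 1) x ≠ 0) ↔
      Relation.ReflTransGen (Edge P) x y := by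
  constructor
  · rintro ⟨t, ht⟩
    induction t generalizing x with
    | zero =>
      by_cases h : x = y
      · rw [h]
      · simp [h] at ht
    | succ t ih =>
      by_contra hx
      rw [Function.iterate_succ', Function.comp] at ht
      refine ht ?_
      rw [killed, lintegral_eq_zero_iff Measurable.of_discrete]
      refine (ae_edge x).mono fun z hz => ?_
      by_contra h
      exact hx (.head hz (ih (by simpa using h)))
  · intro r
    induction r using Relation.ReflTransGen.head_induction_on with
    | refl => exact ⟨0, by simp⟩
    | @head x z e _ ih =>
      obtain ⟨t, ht⟩ := ih
      refine ⟨t + 1, ?_⟩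
      rw [Function.iterate_succ', Function.comp, killed, ← pos_iff_ne_zero]
      refine lt_of_lt_of_le (pos_iff_ne_zero.2 (mul_ne_zero ht e)) ?_
      rw [← lintegral_singleton, ← lintegral_indicator (measurableSet_singleton _)]
      refine lintegral_mono fun w => ?_
      simp only [Set.compl_empty, Set.indicator_univ]
      exact Set.indicator_le_self _ _ w

/-- Up to a given horizon, passing to `G` costs at most as much as passing to `s` first. -/
theorem greenUpTo_le_add {s : S} (T : ℕ) (x : S) :
    greenUpTo P G k T x ≤ green P {s} k x + greenUpTo P G k T s := by
  induction T generalizing x with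
  | zero => simp [greenUpTo]
  | succ T ih =>
    calc greenUpTo P G k (T + 1) x = k x + killed P G (greenUpTo P G k T) x := greenUpTo_succ T x
      _ ≤ k x + ∫⁻ y, (({s} : Set S)ᶜ.indicator (green P {s} k) y + greenUpTo P G k T s) ∂P x := by
          refine add_le_add_right (lintegral_mono fun y => ?_) _
          refine (Set.indicator_le_self _ _ y).trans ?_
          by_cases hy : y = s
          · simp [hy]
          · simpa [hy] using ih y
      _ = green P {s} k x + greenUpTo P G k T s := by
          rw [lintegral_add_right _ measurable_const, lintegral_const, measure_univ, mul_one,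
            ← add_assoc, green_eq (x := x)]
          rfl
      _ ≤ _ := add_le_add_right (greenUpTo_le_succ T s) _

theorem green_le_add {s : S} (x : S) :
    green P G k x ≤ green P {s} k x + green P G k s :=
  green_le_of_greenUpTo_le fun T =>
    (greenUpTo_le_add T x).trans (add_le_add_right (greenUpTo_le_green T s) _)

/-- Induction backwards along a path from `x` to `y`, where the killed value is `0`. The step to the
next vertex `z` of the path has positive probability and carries a coefficient `a < 1`; every other
successor carries coefficient `1` by `greenUpTo_le_add`. The average is again below `1`. Crucially,
`c` and `a` do not depend on `T`. -/
theorem greenUpTo_contracts {s x y : S} (hs : green P {s} k s < ∞)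
    (hx : green P {s} k x < ∞) (hy : y ∈ G) (r : Relation.ReflTransGen (Edge P) x y) :
    ∃ c < ∞, ∃ a < 1, ∀ T, Gᶜ.indicator (greenUpTo P G k T) x ≤ c + a * greenUpTo P G k T s := by
  induction r using Relation.ReflTransGen.head_induction_on with
  | refl => exact ⟨0, by simp, 0, by simp, fun T => by simp [hy]⟩
  | @head x z e _ ih =>
    have hz : green P {s} k z < ∞ := by
      by_cases h : z = s
      · rwa [h]
      · exact green_lt_top_of_edge hx e h
    obtain ⟨c, hc, a, ha, h⟩ := ih hz
    classical
    -- The coefficient after one step; its mean falls short of `1` by `(1 - a) * P x {z}`, which is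
    -- positive.
    set φ : S → ℝ≥0∞ := fun w => if w = z then a else 1 with hφ
    have hφ1 : ∫⁻ w, φ w ∂P x < 1 := by
      have h1 : ∫⁻ w, φ w ∂P x + (1 - a) * P x {z} = 1 := by
        rw [← lintegral_indicator_const (measurableSet_singleton z),
          ← lintegral_add_left Measurable.of_discrete]
        have : ∀ w, φ w + ({z} : Set S).indicator (fun _ => 1 - a) w = 1 := by
          intro w
          by_cases hw : w = z
          · simp [hφ, hw, add_tsub_cancel_of_le ha.le]
          · simp [hφ, hw]
        rw [lintegral_congr this]; simp
      have h2 : (1 - a) * P x {z} ≠ 0 := mul_ne_zero (tsub_pos_of_lt ha).ne' e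
      rw [← h1]
      refine ENNReal.lt_add_right ?_ h2
      intro h3
      rw [h3] at h1
      simp at h1
    refine ⟨c + green P {s} k x, ENNReal.add_lt_top.2 ⟨hc, hx⟩, _, hφ1, fun T => ?_⟩
    -- Raising the horizon to `T + 1` lets one step be unrolled while horizon `T` remains on the
    -- right.
    refine (Set.indicator_le_self _ _ x).trans ((greenUpTo_le_succ T x).trans ?_)
    calc greenUpTo P G k (T + 1) x = k x + killed P G (greenUpTo P G k T) x := greenUpTo_succ T x
      _ ≤ k x + ∫⁻ w, (({s} : Set S)ᶜ.indicator (green P {s} k) w +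
            (c + φ w * greenUpTo P G k T s)) ∂P x := by
          refine add_le_add_right (lintegral_mono fun w => ?_) _
          by_cases hw : w = z
          · subst hw
            simp only [hφ, if_true]
            exact (h T).trans le_add_self
          · simp only [hφ, if_neg hw, one_mul]
            refine (Set.indicator_le_self _ _ w).trans ?_
            by_cases hws : w = s
            · simp [hws]
            · have := greenUpTo_le_add (P := P) (G := G) (k := k) (s := s) T w
              simp only [Set.mem_compl_iff, Set.mem_singleton_iff, hws, not_false_eq_true,
                Set.indicator_of_mem]
              exact this.trans (add_le_add_right le_add_self _)
      _ = c + green P {s} k x + (∫⁻ w, φ w ∂P x) * greenUpTo P G k T s := by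
          rw [lintegral_add_right _ Measurable.of_discrete,
            lintegral_add_right _ Measurable.of_discrete, lintegral_const, measure_univ, mul_one,
            lintegral_mul_const _ Measurable.of_discrete, green_eq (x := x), killed]
          ring

/-- If a return to `s` has finite expected cost and `y` can be reached from `s`, then the passage
from `s` to `y` has finite expected cost. -/
theorem green_lt_top_of_return {s y : S} (hs : green P {s} k s < ∞)
    (hfin : ∀ G T x, greenUpTo P G k T x < ∞)
    (r : Relation.ReflTransGen (Edge P) s y) : green P {y} k s < ∞ := by
  by_cases hsy : s = y
  · rwa [← hsy]
  obtain ⟨c, hc, a, ha, h⟩ := greenUpTo_contracts hs hs (Set.mem_singleton y) r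
  refine (green_le_of_greenUpTo_le (c := c / (1 - a)) fun T => ?_).trans_lt
    (ENNReal.div_lt_top hc.ne (tsub_pos_of_lt ha).ne')
  have h1 := h T
  rw [Set.indicator_of_mem (by exact hsy)] at h1
  -- The truncated value `u` satisfies `u ≤ c + a * u`. Being finite, it may be subtracted, giving
  -- the bound `c / (1 - a)` uniformly in `T`.
  have hu := (hfin {y} T s).ne
  rw [ENNReal.le_div_iff_mul_le (.inl (tsub_pos_of_lt ha).ne') (.inl (by simp)), mul_comm,
    ENNReal.sub_mul (fun _ _ => hu), one_mul]
  exact tsub_le_iff_right.2 h1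

end countable

end chain

end AoI

/-! ### One-step transitions of the channel -/

namespace AoI

variable {M : Channel}

theorem lintegral_step_idle (s : State M) (f : State M → ℝ≥0∞) :
    ∫⁻ x, f x ∂step s .idle = f (freshState M (s.age + 1) (Nat.succ_pos _)) := by
  rw [step, lintegral_dirac]

theorem lintegral_mix (p : ℝ≥0) (x y : State M) (f : State M → ℝ≥0∞) :
    ∫⁻ z, f z ∂(p • Measure.dirac x + (1 - p) • Measure.dirac y) =
      p * f x + (1 - p : ℝ≥0) * f y := by
  rw [lintegral_add_measure]
  simp only [lintegral_smul_measure, lintegral_dirac, ENNReal.smul_def, smul_eq_mul]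

theorem lintegral_step_new (s : State M) (f : State M → ℝ≥0∞) :
    ∫⁻ x, f x ∂step s .new =
      M.g 0 * f (failState M s.age 0 (Nat.zero_lt_of_lt s.2.1) (by simp)) +
        (1 - M.g 0 : ℝ≥0) * f (startState M) :=
  lintegral_mix _ _ _ _

theorem lintegral_step_retx (s : State M) (f : State M → ℝ≥0∞) :
    ∫⁻ x, f x ∂step s .retx =
      M.g s.att * f (failState M s.age s.att s.2.1 s.2.2) +
        (1 - M.g s.att : ℝ≥0) * f (freshState M (s.att + 1) (Nat.succ_pos _)) :=
  lintegral_mix _ _ _ _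

theorem lintegral_step_lt_top (s : State M) (a : Act) {f : State M → ℝ≥0∞} (hf : ∀ x, f x < ∞) :
    ∫⁻ x, f x ∂step s a < ∞ := by
  cases a
  · rw [lintegral_step_idle]; exact hf _
  · rw [lintegral_step_new]
    exact ENNReal.add_lt_top.2 ⟨ENNReal.mul_lt_top (by simp) (hf _),
      ENNReal.mul_lt_top ENNReal.coe_lt_top (hf _)⟩
  · rw [lintegral_step_retx]
    exact ENNReal.add_lt_top.2 ⟨ENNReal.mul_lt_top (by simp) (hf _),
      ENNReal.mul_lt_top ENNReal.coe_lt_top (hf _)⟩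

theorem step_apply (s : State M) (a : Act) (y : State M) :
    step s a {y} = ∫⁻ x, ({y} : Set (State M)).indicator 1 x ∂step s a := by
  rw [lintegral_indicator_one (measurableSet_singleton y)]

theorem step_idle_ne_zero {s y : State M} :
    step s .idle {y} ≠ 0 ↔ y = freshState M (s.age + 1) (Nat.succ_pos _) := by
  rw [step_apply, lintegral_step_idle]
  simp [Set.indicator_apply, eq_comm]

theorem mul_indicator_singleton_eq_zero {c : ℝ≥0∞} (hc : c ≠ 0) (x y : State M) :
    c * ({y} : Set (State M)).indicator 1 x = 0 ↔ y ≠ x := by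
  rw [mul_eq_zero_iff_left hc]
  by_cases h : x = y
  · simp [h]
  · simp [h, Ne.symm h]

theorem step_new_ne_zero {s y : State M} :
    step s .new {y} ≠ 0 ↔
      y = failState M s.age 0 (Nat.zero_lt_of_lt s.2.1) (by simp) ∨ y = startState M := by
  rw [step_apply, lintegral_step_new, Ne, add_eq_zero, not_and_or,
    mul_indicator_singleton_eq_zero (ENNReal.coe_ne_zero.2 M.g_zero_pos.ne'),
    mul_indicator_singleton_eq_zero
      (ENNReal.coe_ne_zero.2 (tsub_pos_of_lt M.g_zero_lt_one).ne'), not_ne_iff, not_ne_iff]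

theorem eq_of_step_retx_ne_zero {s y : State M} (h : step s .retx {y} ≠ 0) :
    y = failState M s.age s.att s.2.1 s.2.2 ∨
      y = freshState M (s.att + 1) (Nat.succ_pos _) := by
  rw [step_apply, lintegral_step_retx] at h
  by_contra! hne
  exact h (by simp [hne.1.symm, hne.2.symm])

theorem step_retx_fail_ne_zero {s : State M} (h : 0 < M.g s.att) :
    step s .retx {failState M s.age s.att s.2.1 s.2.2} ≠ 0 := by
  rw [step_apply, lintegral_step_retx]
  simp [h.ne']

theorem age_le_of_step_ne_zero {s y : State M} {a : Act} (h : step s a {y} ≠ 0) :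
    y.age ≤ s.age + 1 := by
  cases a
  · rw [step_idle_ne_zero.1 h]; exact le_rfl
  · rcases step_new_ne_zero.1 h with rfl | rfl
    · exact le_rfl
    · exact Nat.le_add_left 1 s.age
  · rcases eq_of_step_retx_ne_zero h with rfl | rfl
    · exact le_rfl
    · exact Nat.succ_le_succ s.2.1.le

/-! ### Drift bounds and reachability under stationary policies -/

section stationary

variable {q : State M → PMF Act} {hq : ∀ s, ∀ a ∈ (q s).support, Admissible s a}

theorem trans_apply (s : State M) (A : Set (State M)) :
    trans q s A = ∑ a, q s a * step s a A := by
  simp [trans, Measure.finsetSum_apply]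

theorem edge_trans_iff {s y : State M} :
    Edge (trans q) s y ↔ ∃ a, q s a ≠ 0 ∧ step s a {y} ≠ 0 := by
  rw [Edge, trans_apply, Ne, Finset.sum_eq_zero_iff]
  simp

theorem age_le_of_edge {s y : State M} (h : Edge (trans q) s y) : y.age ≤ s.age + 1 :=
  let ⟨_, _, ha⟩ := edge_trans_iff.1 h
  age_le_of_step_ne_zero ha

theorem killed_trans_lt_top {f : State M → ℝ≥0∞} (hf : ∀ x, f x < ∞) (G : Set (State M))
    (s : State M) : killed (trans q) G f s < ∞ := by
  rw [killed, lintegral_trans]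
  refine ENNReal.sum_lt_top.2 fun a _ => ENNReal.mul_lt_top ((q s).apply_ne_top a).lt_top
    (lintegral_step_lt_top s a fun x => (Set.indicator_le_self _ _ x).trans_lt (hf x))

theorem greenUpTo_trans_lt_top {k : State M → ℝ≥0∞} (hk : ∀ x, k x < ∞) (G : Set (State M))
    (T : ℕ) (x : State M) : greenUpTo (trans q) G k T x < ∞ := by
  refine ENNReal.sum_lt_top.2 fun t ht => ?_
  clear ht
  induction t generalizing x with
  | zero => exact hk x
  | succ t ih =>
    rw [Function.iterate_succ_apply']
    exact killed_trans_lt_top ih G x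

theorem actMean_ageCost :
    actMean q (fun p => (ageCost p.1 p.2 : ℝ≥0∞)) = fun s => (s.age : ℝ≥0∞) := by
  have := actMean_of_fst (q := q) fun s => (s.age : ℝ≥0∞)
  simpa [ageCost] using this

theorem actMean_txCost_le (s : State M) :
    actMean q (fun p => (txCost p.1 p.2 : ℝ≥0∞)) s ≤ 1 := by
  rw [← PMF_sum_eq_one (q s)]
  refine Finset.sum_le_sum fun a _ => mul_le_of_le_one_right' ?_
  simp only [txCost]
  split_ifs <;> simp

/-- A finite passage cost for `age + 2` puts the stationary policy into `passageClassStar`. -/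
theorem mem_passageClassStar {s : State M} {G : Set (State M)}
    (h : green (trans q) G (fun x => (x.age : ℝ≥0∞) + 2) s < ∞) :
    Policy.stationary q hq ∈ passageClassStar s G := by
  have ht : (Policy.stationary q hq).expPassageTime s G < ∞ := by
    rw [expPassageTime_eq]
    refine (green_mono (fun x => ?_) s).trans_lt h
    exact le_add_of_le_right (by simp)
  refine ⟨⟨passageProb_eq_one ht, ht⟩, ?_, ?_⟩
  · rw [expPassageCost_eq, actMean_ageCost]
    exact (green_mono (fun x => le_self_add) s).trans_lt h
  · rw [expPassageCost_eq]
    refine (green_mono (fun x => (actMean_txCost_le x).trans ?_) s).trans_lt h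
    exact le_add_of_le_right (by simp)

theorem trans_compl_le {e : ℝ≥0} {s y : State M} (h : (e : ℝ≥0∞) ≤ trans q s {y}) :
    trans q s {y}ᶜ ≤ (1 - e : ℝ≥0) := by
  rw [prob_compl_eq_one_sub (measurableSet_singleton y), ENNReal.coe_sub, ENNReal.coe_one]
  exact tsub_le_tsub_left h 1

/-- Age rises by at most one, and at most mass `1 - e` survives the killing at `(1, 0)`. -/
theorem killed_le_of_age {e a b : ℝ≥0} {s : State M}
    (h : (e : ℝ≥0∞) ≤ trans q s {startState M}) :
    killed (trans q) {startState M} (fun x => (a + b * x.age : ℝ≥0)) s ≤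
      ((a + b * (s.age + 1)) * (1 - e) : ℝ≥0) := by
  rw [killed, lintegral_indicator MeasurableSet.of_discrete]
  refine (setLIntegral_mono_ae (g := fun _ => ((a + b * (s.age + 1) : ℝ≥0) : ℝ≥0∞))
    measurable_const.aemeasurable ((ae_edge s).mono fun y hy _ => ?_)).trans ?_
  · have : (y.age : ℝ≥0) ≤ s.age + 1 := by exact_mod_cast age_le_of_edge hy
    rw [ENNReal.coe_le_coe]
    gcongr
  · rw [setLIntegral_const, ENNReal.coe_mul]
    gcongr
    exact trans_compl_le h

theorem green_start_lt_top {e : ℝ≥0} (he : 0 < e)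
    (h : ∀ s, (e : ℝ≥0∞) ≤ trans q s {startState M}) (s : State M) :
    green (trans q) {startState M} (fun x => (x.age : ℝ≥0∞) + 2) s < ∞ := by
  have he1 : e ≤ 1 := by exact_mod_cast (h s).trans prob_le_one
  refine (green_le_killed_of_drift
    -- For `W = a + b * age` the age coefficients balance when `1 + b * (1 - e) = b`, so `b = e⁻¹`.
    -- The choice `a = e⁻¹ * (2 + b)` then leaves slack exactly `1` in the constant term.
    (W := fun x => ((e⁻¹ * (2 + e⁻¹) + e⁻¹ * x.age : ℝ≥0) : ℝ≥0∞)) (fun x _ => ?_) s).trans_lt ?_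
  · refine (add_le_add_right (killed_le_of_age (h x)) _).trans ?_
    have : (x.age : ℝ≥0) + 2 + (e⁻¹ * (2 + e⁻¹) + e⁻¹ * (x.age + 1)) * (1 - e) ≤
        e⁻¹ * (2 + e⁻¹) + e⁻¹ * x.age := by
      rw [← NNReal.coe_le_coe]
      push_cast [NNReal.coe_sub he1]
      have he' : (0 : ℝ) < e := he
      have : (x.age : ℝ) + 2 + ((e : ℝ)⁻¹ * (2 + (e : ℝ)⁻¹) + (e : ℝ)⁻¹ * (x.age + 1)) * (1 - e) =
        (e : ℝ)⁻¹ * (2 + (e : ℝ)⁻¹) + (e : ℝ)⁻¹ * x.age - 1 := by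
        field_simp
        ring
      linarith
    exact_mod_cast this
  · refine ENNReal.add_lt_top.2 ⟨?_, killed_trans_lt_top (fun _ => ENNReal.coe_lt_top) _ _⟩
    exact ENNReal.add_lt_top.2 ⟨by simp, by simp⟩

/-- Foster–Lyapunov: iterating the drift bounds the cost of the first `T` steps by `V s + T * b`;
divide by `T`. -/
theorem avgCost_lt_top_of_drift {k : State M → Act → ℝ≥0} {V : State M → ℝ≥0∞} {b : ℝ≥0∞}
    (hb : b < ∞) (hV : ∀ s, V s < ∞)
    (h : ∀ s, actMean q (fun p => k p.1 p.2) s + killed (trans q) ∅ V s ≤ V s + b) (s : State M) :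
    (Policy.stationary q hq).avgCost s k < ∞ := by
  set κ := actMean q (fun p => (k p.1 p.2 : ℝ≥0∞))
  have key : ∀ T s, greenUpTo (trans q) ∅ κ T s ≤ V s + T * b := by
    intro T
    induction T with
    | zero => simp [greenUpTo]
    | succ T ih =>
      intro s
      have h1 : killed (trans q) ∅ (greenUpTo (trans q) ∅ κ T) s ≤
          killed (trans q) ∅ V s + T * b := by
        refine (killed_mono ih s).trans_eq ?_
        simp only [killed, Set.compl_empty, Set.indicator_univ]
        rw [lintegral_add_right _ measurable_const, lintegral_const, measure_univ, mul_one]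
      rw [greenUpTo_succ]
      calc κ s + killed (trans q) ∅ (greenUpTo (trans q) ∅ κ T) s
          ≤ κ s + killed (trans q) ∅ V s + T * b := by rw [add_assoc]; gcongr
        _ ≤ V s + b + T * b := add_le_add_left (h s) _
        _ = V s + (T + 1 : ℕ) * b := by push_cast; ring
  rw [avgCost_eq]
  -- The times `1, …, T` lie among the first `T + 1` steps, and `T + 1 ≤ 2 * T`.
  refine lt_of_le_of_lt (b := V s + 2 * b) ?_
    (ENNReal.add_lt_top.2 ⟨hV s, ENNReal.mul_lt_top (by simp) hb⟩)
  refine limsup_le_of_le (by isBoundedDefault) ?_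
  filter_upwards [eventually_ge_atTop 1] with T hT
  refine ENNReal.div_le_of_le_mul ?_
  have hT' : (1 : ℝ≥0∞) ≤ T := by exact_mod_cast hT
  calc _ ≤ greenUpTo (trans q) ∅ κ (T + 1) s := by
        refine Finset.sum_le_sum_of_subset fun t ht => ?_
        simp only [Finset.mem_Icc, Finset.mem_range] at ht ⊢
        omega
    _ ≤ V s + (T + 1 : ℕ) * b := key _ s
    _ = V s * 1 + (T + 1) * b := by push_cast; ring
    _ ≤ V s * T + (T + T) * b := by gcongr
    _ = (V s + 2 * b) * T := by ring

theorem J_lt_top {e : ℝ≥0} (he : 0 < e)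
    (h : ∀ s, (e : ℝ≥0∞) ≤ trans q s {startState M}) (s : State M) :
    (Policy.stationary q hq).J s < ∞ := by
  have he1 : e ≤ 1 := by exact_mod_cast (h s).trans prob_le_one
  refine avgCost_lt_top_of_drift (V := fun x => ((0 + e⁻¹ * x.age : ℝ≥0) : ℝ≥0∞))
    (b := ((2 * e⁻¹ : ℝ≥0) : ℝ≥0∞)) ENNReal.coe_lt_top (fun _ => ENNReal.coe_lt_top)
    (fun x => ?_) s
  -- Without killing, the entry into `(1, 0)` adds at most the value there, `e⁻¹`, since the age is
  -- `1`. The summand `0` matches `killed_le_of_age`.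
  have h1 : killed (trans q) ∅ (fun x => ((0 + e⁻¹ * x.age : ℝ≥0) : ℝ≥0∞)) x ≤
      (e⁻¹ : ℝ≥0) + killed (trans q) {startState M}
        (fun x => ((0 + e⁻¹ * x.age : ℝ≥0) : ℝ≥0∞)) x := by
    have : ((e⁻¹ : ℝ≥0) : ℝ≥0∞) = ∫⁻ _, ((e⁻¹ : ℝ≥0) : ℝ≥0∞) ∂trans q x := by simp
    rw [this, killed, killed, ← lintegral_add_left measurable_const]
    refine lintegral_mono fun y => ?_
    by_cases hy : y = startState M
    · subst hy
      simp [startState, freshState, State.age]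
    · simp [hy]
  rw [actMean_ageCost]
  refine (add_le_add_right (h1.trans (add_le_add_right (killed_le_of_age (h x)) _)) _).trans ?_
  have : (x.age : ℝ≥0) + (e⁻¹ + (0 + e⁻¹ * (x.age + 1)) * (1 - e)) ≤
      0 + e⁻¹ * x.age + 2 * e⁻¹ := by
    rw [← NNReal.coe_le_coe]
    push_cast [NNReal.coe_sub he1]
    have he' : (0 : ℝ) < e := he
    have : (x.age : ℝ) + ((e : ℝ)⁻¹ + (0 + (e : ℝ)⁻¹ * (x.age + 1)) * (1 - e)) =
      0 + (e : ℝ)⁻¹ * x.age + 2 * (e : ℝ)⁻¹ - 1 := by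
      field_simp
      ring
    linarith
  beta_reduce
  exact_mod_cast this

theorem avgCost_le_of_actMean_le {k : State M → Act → ℝ≥0} {c : ℝ≥0∞}
    (h : ∀ s, actMean q (fun p => k p.1 p.2) s ≤ c) (s : State M) :
    (Policy.stationary q hq).avgCost s k ≤ c := by
  have key : ∀ t s, (killed (trans q) ∅)^[t] (actMean q fun p => k p.1 p.2) s ≤ c := by
    intro t
    induction t with
    | zero => exact h
    | succ t ih =>
      intro s
      rw [Function.iterate_succ_apply', killed]
      refine lintegral_le_of_edge fun y _ => ?_
      simpa using ih y
  rw [avgCost_eq]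
  refine limsup_le_of_le (by isBoundedDefault) (Eventually.of_forall fun T => ?_)
  refine ENNReal.div_le_of_le_mul ?_
  refine (Finset.sum_le_sum fun t _ => key t s).trans ?_
  simp [mul_comm]

theorem reaches_iff {s y : State M} :
    0 < (Policy.stationary q hq).law s {ω | ∃ t, (ω t).1 = y} ↔
      Relation.ReflTransGen (Edge (trans q)) s y := by
  rw [← exists_iterate_ne_zero_iff, Set.ofPred_exists, pos_iff_ne_zero, Ne, measure_iUnion_null_iff]
  simp only [law_eq_iterate, not_forall]

theorem passageProb_eq_zero {s y : State M}
    (h : ¬ Relation.TransGen (Edge (trans q)) s y) :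
    (Policy.stationary q hq).passageProb s {y} = 0 := by
  have h1 : {ω : ℕ → State M × Act | ∃ t, 1 ≤ t ∧ (ω t).1 ∈ ({y} : Set (State M))} ⊆
      ⋃ t, {ω | (ω (t + 1)).1 = y} := by
    rintro ω ⟨t, ht, hy⟩
    exact Set.mem_iUnion.2 ⟨t - 1, by rw [Nat.sub_add_cancel ht]; exact hy⟩
  refine measure_mono_null h1 (measure_iUnion_null fun t => ?_)
  rw [law_eq_iterate, Function.iterate_succ_apply', killed,
    lintegral_eq_zero_iff Measurable.of_discrete]
  refine (ae_edge s).mono fun z hz => ?_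
  by_contra hne
  exact h (.head' hz (exists_iterate_ne_zero_iff.1 ⟨t, by simpa using hne⟩))

end stationary

end AoI

namespace AoI

variable {M : Channel}

open Relation

/-! ### Recurrence classes of deterministic policies -/

namespace DetPolicy

/-- The transition law of the chain induced by a deterministic policy. -/
def chain (f : DetPolicy M) : State M → Measure (State M) :=
  trans fun s => PMF.pure (f.act s)

instance (f : DetPolicy M) (s : State M) : IsProbabilityMeasure (f.chain s) := by
  unfold chain; infer_instance

theorem chain_apply (f : DetPolicy M) (s : State M) : f.chain s = step s (f.act s) := by
  rw [chain, trans, Finset.sum_eq_single (f.act s)]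
  · simp
  · intro a _ ha
    simp [PMF.pure_apply, ha]
  · simp

theorem edge_iff {f : DetPolicy M} {s y : State M} :
    Edge f.chain s y ↔ step s (f.act s) {y} ≠ 0 := by
  rw [Edge, chain_apply]

theorem admissible_pure (f : DetPolicy M) (s : State M) :
    ∀ a ∈ (PMF.pure (f.act s)).support, Admissible s a :=
  f.toPolicy.admissible 0 Fin.elim0 s

theorem toPolicy_eq (f : DetPolicy M) :
    f.toPolicy = Policy.stationary (fun s => PMF.pure (f.act s)) f.admissible_pure :=
  rfl

theorem posRecurrent_iff {f : DetPolicy M} {s : State M} :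
    f.PosRecurrent s ↔ green f.chain {s} 1 s < ∞ := by
  rw [PosRecurrent, toPolicy_eq, expPassageTime_eq]
  rfl

theorem reaches_iff_reflTransGen {f : DetPolicy M} {s y : State M} :
    f.Reaches s y ↔ ReflTransGen (Edge f.chain) s y := by
  rw [Reaches, toPolicy_eq, reaches_iff]
  rfl

theorem PosRecurrent.transGen {f : DetPolicy M} {s : State M} (h : f.PosRecurrent s) :
    TransGen (Edge f.chain) s s :=
  transGen_of_green_lt_top (posRecurrent_iff.1 h)

theorem PosRecurrent.reaches_symm {f : DetPolicy M} {s y : State M} (h : f.PosRecurrent s)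
    (r : f.Reaches s y) : f.Reaches y s := by
  rw [reaches_iff_reflTransGen] at r ⊢
  exact (transGen_of_green_lt_top (green_lt_top_of_reach (posRecurrent_iff.1 h) r)).to_reflTransGen

/-- A return to `y` is bounded by a passage from `y` to `s` followed by one from `s` to `y`, both of
finite mean. -/
theorem PosRecurrent.of_reaches {f : DetPolicy M} {s y : State M} (h : f.PosRecurrent s)
    (r : f.Reaches s y) : f.PosRecurrent y := by
  rw [reaches_iff_reflTransGen] at r
  rw [posRecurrent_iff] at h ⊢
  have h1 := green_lt_top_of_reach h r
  have h2 : green f.chain {y} 1 s < ∞ :=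
    green_lt_top_of_return h (fun G T x => greenUpTo_trans_lt_top (by simp) G T x) r
  exact (green_le_add y).trans_lt (ENNReal.add_lt_top.2 ⟨h1, h2⟩)

theorem Reaches.trans {f : DetPolicy M} {x y z : State M} (h : f.Reaches x y)
    (h' : f.Reaches y z) : f.Reaches x z := by
  rw [reaches_iff_reflTransGen] at *
  exact h.trans h'

theorem reaches_refl (f : DetPolicy M) (x : State M) : f.Reaches x x :=
  reaches_iff_reflTransGen.2 .refl

/-- The communication class of `s`. -/
def commClass (f : DetPolicy M) (s : State M) : Set (State M) :=
  {y | f.Reaches s y ∧ f.Reaches y s}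

theorem PosRecurrent.isPosRecurrentClass {f : DetPolicy M} {s : State M} (h : f.PosRecurrent s) :
    f.IsPosRecurrentClass (f.commClass s) :=
  ⟨⟨s, rfl⟩, fun _ hy => h.of_reaches hy.1⟩

theorem commClass_eq {f : DetPolicy M} {s y : State M} (h : f.Reaches s y)
    (h' : f.Reaches y s) : f.commClass s = f.commClass y := by
  ext z
  exact ⟨fun hz => ⟨h'.trans hz.1, hz.2.trans h⟩, fun hz => ⟨h.trans hz.1, hz.2.trans h'⟩⟩

/-- Without new updates a state is never revisited: the age grows until a retransmission succeeds,
and from then on no retransmission is possible. -/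
theorem not_transGen_self_of_no_new {f : DetPolicy M} {s : State M}
    (h : ∀ x, ReflTransGen (Edge f.chain) s x → f.act x ≠ .new) :
    ¬ TransGen (Edge f.chain) s s := by
  -- The second alternative records a successful retransmission: the attempt count is then stuck at
  -- `0`, whereas that of `s` is positive. Either alternative excludes `x = s`.
  have key : ∀ x, TransGen (Edge f.chain) s x →
      (s.age < x.age ∧ (s.att = 0 → x.att = 0)) ∨ (x.att = 0 ∧ 0 < s.att) := by
    intro x hx
    induction hx with
    | @single x e =>
      rw [edge_iff] at e
      have hn := h s .refl
      have ha := f.admissible s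
      cases hact : f.act s with
      | new => exact absurd hact hn
      | idle =>
        rw [hact, step_idle_ne_zero] at e
        subst e
        exact .inl ⟨Nat.lt_succ_self _, fun _ => rfl⟩
      | retx =>
        rw [hact] at e
        have h0 : 0 < s.att := ha hact
        rcases eq_of_step_retx_ne_zero e with rfl | rfl
        · exact .inl ⟨Nat.lt_succ_self _, fun h => absurd h h0.ne'⟩
        · exact .inr ⟨rfl, h0⟩
    | @tail y x hy e ih =>
      rw [edge_iff] at e
      have hn := h y hy.to_reflTransGen
      have ha := f.admissible y
      cases hact : f.act y with
      | new => exact absurd hact hn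
      | idle =>
        rw [hact, step_idle_ne_zero] at e
        subst e
        rcases ih with ih | ih
        · exact .inl ⟨ih.1.trans (Nat.lt_succ_self _), fun _ => rfl⟩
        · exact .inr ⟨rfl, ih.2⟩
      | retx =>
        rw [hact] at e
        have h0 : 0 < y.att := ha hact
        rcases ih with ih | ih
        · have hs : 0 < s.att := Nat.pos_of_ne_zero fun h => h0.ne' (ih.2 h)
          rcases eq_of_step_retx_ne_zero e with rfl | rfl
          · exact .inl ⟨ih.1.trans (Nat.lt_succ_self _), fun h => absurd h hs.ne'⟩
          · exact .inr ⟨rfl, hs⟩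
        · exact absurd ih.1 h0.ne'
  intro hs
  rcases key s hs with h | h
  · exact lt_irrefl _ h.1
  · exact h.2.ne' h.1

/-- A positive recurrent state lies on a cycle, so some state reachable from it sends a new update,
whose success leads to `(1, 0)`. -/
theorem PosRecurrent.reaches_start {f : DetPolicy M} {s : State M} (h : f.PosRecurrent s) :
    f.Reaches s (startState M) := by
  rw [reaches_iff_reflTransGen]
  by_contra hs
  refine not_transGen_self_of_no_new (fun x hx hact => hs (hx.tail ?_)) h.transGen
  rw [edge_iff, hact]
  exact step_new_ne_zero.2 (.inr rfl)

theorem existsUnique_isPosRecurrentClass (f : DetPolicy M) (h : ∃ s, f.PosRecurrent s) :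
    ∃ R, f.IsPosRecurrentClass R ∧ startState M ∈ R ∧ ∀ R', f.IsPosRecurrentClass R' → R' = R := by
  obtain ⟨s, hs⟩ := h
  refine ⟨f.commClass (startState M), (hs.of_reaches hs.reaches_start).isPosRecurrentClass,
    ⟨f.reaches_refl _, f.reaches_refl _⟩, ?_⟩
  rintro R' ⟨⟨y, rfl⟩, hR⟩
  have hy : f.PosRecurrent y := hR y ⟨f.reaches_refl _, f.reaches_refl _⟩
  exact commClass_eq hy.reaches_start (hy.reaches_symm hy.reaches_start)

/-- The policy that sends a new update at every time. -/
def alwaysNew (M : Channel) : DetPolicy M where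
  act _ := .new
  admissible _ h := by cases h

end DetPolicy

theorem le_trans_start {q : State M → PMF Act} {e : ℝ≥0} {s : State M}
    (h : (e : ℝ≥0∞) ≤ q s .new) :
    ((e * (1 - M.g 0) : ℝ≥0) : ℝ≥0∞) ≤ trans q s {startState M} := by
  have h1 : ((1 - M.g 0 : ℝ≥0) : ℝ≥0∞) ≤ step s .new {startState M} := by
    rw [step_apply, lintegral_step_new]
    simp
  rw [trans_apply, ENNReal.coe_mul]
  exact (mul_le_mul' h h1).trans
    (Finset.single_le_sum (f := fun a => q s a * step s a {startState M})
      (fun _ _ => zero_le) (Finset.mem_univ Act.new))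

theorem one_sub_g_pos (M : Channel) : 0 < 1 - M.g 0 := tsub_pos_of_lt M.g_zero_lt_one

namespace DetPolicy

theorem alwaysNew_le (s : State M) :
    ((1 * (1 - M.g 0) : ℝ≥0) : ℝ≥0∞) ≤
      trans (fun s => PMF.pure ((alwaysNew M).act s)) s {startState M} :=
  le_trans_start (by simp [alwaysNew])

theorem alwaysNew_edge_start (s : State M) : Edge (alwaysNew M).chain s (startState M) :=
  edge_iff.2 (step_new_ne_zero.2 (.inr rfl))

theorem alwaysNew_reaches_start (s : State M) : (alwaysNew M).Reaches s (startState M) :=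
  reaches_iff_reflTransGen.2 (.single (alwaysNew_edge_start s))

theorem alwaysNew_start_reaches_fail (δ : ℕ) (h : 0 < δ) :
    (alwaysNew M).Reaches (startState M) (failState M δ 0 h (by simp)) := by
  induction δ, h using Nat.le_induction with
  | base =>
    exact reaches_iff_reflTransGen.2 (.single (edge_iff.2 (step_new_ne_zero.2 (.inl rfl))))
  | succ δ h ih =>
    refine ih.trans (reaches_iff_reflTransGen.2 (.single (edge_iff.2 (step_new_ne_zero.2 (.inl ?_)))))
    rfl

/-- A single step from anywhere enters the class of `(1, 0)`: success gives `(1, 0)`, and the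
failure state is also reached from `(1, 0)` by repeated failures. So states outside the class are
never revisited and enter it at time `1`. -/
theorem alwaysNew_mem_class_of_edge {s y : State M} (h : Edge (alwaysNew M).chain s y) :
    y ∈ (alwaysNew M).commClass (startState M) := by
  refine ⟨?_, alwaysNew_reaches_start y⟩
  rcases step_new_ne_zero.1 (edge_iff.1 h) with rfl | rfl
  · exact alwaysNew_start_reaches_fail _ _
  · exact reaches_refl _ _

theorem alwaysNew_posRecurrent_start : (alwaysNew M).PosRecurrent (startState M) := by
  rw [posRecurrent_iff]
  refine (green_mono (fun x => ?_) _).trans_lt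
    (green_start_lt_top (mul_pos one_pos (one_sub_g_pos M)) alwaysNew_le _)
  exact le_add_of_le_right (by simp)

theorem alwaysNew_isTransient {s : State M} (h : s ∉ (alwaysNew M).commClass (startState M)) :
    (alwaysNew M).IsTransient s := by
  have h1 : ¬ TransGen (Edge (alwaysNew M).chain) s s := by
    intro hs
    obtain ⟨y, -, hy⟩ := TransGen.tail'_iff.1 hs
    exact h (alwaysNew_mem_class_of_edge hy)
  rw [IsTransient, toPolicy_eq, passageProb_eq_zero h1]
  exact zero_lt_one

theorem alwaysNew_mem_passageClassStar (s : State M) :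
    (alwaysNew M).toPolicy ∈ passageClassStar s ((alwaysNew M).commClass (startState M)) := by
  rw [toPolicy_eq]
  refine mem_passageClassStar ?_
  have h0 : (alwaysNew M).chain s ((alwaysNew M).commClass (startState M))ᶜ = 0 :=
    measure_eq_zero_of_not_edge fun y hy e => hy (alwaysNew_mem_class_of_edge e)
  have h1 := green_eq_of_killed_zero (k := fun x => (x.age : ℝ≥0∞) + 2) h0
  rw [chain] at h1
  rw [h1]
  exact ENNReal.add_lt_top.2 ⟨by simp, by simp⟩

theorem exists_unichain (M : Channel) :
    ∃ f : DetPolicy M, ∃ R U : Set (State M),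
      R ∪ U = Set.univ ∧ Disjoint R U ∧ f.IsPosRecurrentClass R ∧
      (∀ s ∈ U, f.IsTransient s ∧ f.toPolicy ∈ passageClassStar s R) ∧
      (∀ s ∈ R, f.toPolicy.J s < ⊤ ∧ f.toPolicy.C s < ⊤) := by
  refine ⟨alwaysNew M, (alwaysNew M).commClass (startState M), _, Set.union_compl_self _,
    disjoint_compl_right, alwaysNew_posRecurrent_start.isPosRecurrentClass,
    fun s hs => ⟨alwaysNew_isTransient hs, alwaysNew_mem_passageClassStar s⟩, fun s _ => ?_⟩
  rw [toPolicy_eq]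
  exact ⟨J_lt_top (mul_pos one_pos (one_sub_g_pos M)) alwaysNew_le s,
    (avgCost_le_of_actMean_le actMean_txCost_le s).trans_lt ENNReal.one_lt_top⟩

end DetPolicy

/-! ### Passage between arbitrary states under the uniform rule -/

section uniform

theorem admissible_new (s : State M) : Admissible s .new := fun h => by cases h

theorem admissible_idle (s : State M) : Admissible s .idle := fun h => by cases h

open Classical in
/-- The admissible actions in state `s`. -/
def admissibleActs (s : State M) : Finset Act := {a | Admissible s a}

theorem mem_admissibleActs {s : State M} {a : Act} : a ∈ admissibleActs s ↔ Admissible s a := by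
  simp [admissibleActs]

theorem admissibleActs_nonempty (s : State M) : (admissibleActs s).Nonempty :=
  ⟨.new, mem_admissibleActs.2 (admissible_new s)⟩

/-- The uniform distribution on the admissible actions. -/
def uniformRule (s : State M) : PMF Act :=
  PMF.uniformOfFinset (admissibleActs s) (admissibleActs_nonempty s)

theorem uniformRule_ne_zero {s : State M} {a : Act} : uniformRule s a ≠ 0 ↔ Admissible s a := by
  rw [← PMF.mem_support_iff, uniformRule, PMF.mem_support_uniformOfFinset_iff, mem_admissibleActs]

theorem third_le_uniformRule_new (s : State M) : ((3⁻¹ : ℝ≥0) : ℝ≥0∞) ≤ uniformRule s .new := by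
  rw [uniformRule, PMF.uniformOfFinset_apply_of_mem _ (mem_admissibleActs.2 (admissible_new s)),
    ENNReal.coe_inv (by norm_num)]
  refine ENNReal.inv_le_inv.2 ?_
  have : (admissibleActs s).card ≤ 3 := (Finset.card_le_univ _).trans (by decide)
  exact_mod_cast this

theorem edge_uniform_of_step {s y : State M} {a : Act} (ha : Admissible s a)
    (h : step s a {y} ≠ 0) : Edge (trans uniformRule) s y :=
  edge_trans_iff.2 ⟨a, uniformRule_ne_zero.2 ha, h⟩

theorem uniform_reaches_fresh (δ : ℕ) (h : 0 < δ) :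
    ReflTransGen (Edge (trans uniformRule)) (startState M) (freshState M δ h) := by
  induction δ, h using Nat.le_induction with
  | base => exact .refl
  | succ δ h ih =>
    exact ih.tail (edge_uniform_of_step (a := .idle) (admissible_idle _)
      (step_idle_ne_zero.2 rfl))

/-- Idle up to `(d, 0)`, then fail `r` times in a row, the first attempt being a new update. Each
failure is possible because `g` is positive below `rmax`. -/
theorem uniform_reaches_add (d r : ℕ) (hd : 0 < d) (hr : (r : ℕ∞) ≤ M.rmax) :
    ReflTransGen (Edge (trans uniformRule)) (startState M)
      (⟨(d + r, r), Nat.lt_add_of_pos_left hd, hr⟩ : State M) := by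
  induction r with
  | zero => exact uniform_reaches_fresh d hd
  | succ r ih =>
    have hlt : (r : ℕ∞) < M.rmax := lt_of_lt_of_le (by exact_mod_cast r.lt_succ_self) hr
    refine (ih hlt.le).tail ?_
    have hf : ∀ (h1 : r < d + r) (h2 : (r : ℕ∞) ≤ M.rmax),
        failState M (d + r) r h1 h2 = ⟨(d + (r + 1), r + 1), Nat.lt_add_of_pos_left hd, hr⟩ := by
      intro h1 h2
      apply Subtype.ext
      simp only [failState, if_pos hr]
      rfl
    rcases Nat.eq_zero_or_pos r with rfl | h0
    · refine edge_uniform_of_step (a := .new) (admissible_new _) (step_new_ne_zero.2 (.inl ?_))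
      exact (hf _ _).symm
    · refine edge_uniform_of_step (a := .retx) (fun _ => h0) ?_
      rw [← hf (Nat.lt_add_of_pos_left hd) hlt.le]
      exact step_retx_fail_ne_zero (M.g_pos_of_lt r hlt)

theorem uniform_reaches (s : State M) :
    ReflTransGen (Edge (trans uniformRule)) (startState M) s := by
  obtain ⟨⟨δ, r⟩, h1, h2⟩ := s
  have e : δ - r + r = δ := Nat.sub_add_cancel h1.le
  have h := uniform_reaches_add (M := M) (δ - r) r (Nat.sub_pos_of_lt h1) h2
  simp only [e] at h
  exact h

/-- The passage is routed through `(1, 0)`: the drift bound covers the first leg, the return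
argument the second. -/
theorem exists_mem_passageClassStar (s s' : State M) :
    ∃ π : Policy M, π ∈ passageClassStar s {s'} := by
  refine ⟨Policy.stationary uniformRule
    fun s a ha => uniformRule_ne_zero.1 ((PMF.mem_support_iff _ _).1 ha),
    mem_passageClassStar ?_⟩
  have h (x : State M) := green_start_lt_top (mul_pos (by norm_num) (one_sub_g_pos M))
    (fun s => le_trans_start (third_le_uniformRule_new s)) x
  refine (green_le_add s).trans_lt (ENNReal.add_lt_top.2 ⟨h s, ?_⟩)
  exact green_lt_top_of_return (h _)
    (fun G T x => greenUpTo_trans_lt_top (fun x => ENNReal.add_lt_top.2 ⟨by simp, by simp⟩) G T x)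
    (uniform_reaches s')

end uniform

/-! ### Randomized transmission and the cost constraint -/

section bernoulli

/-- Send a new update with probability `p` and idle otherwise. -/
def bernoulliRule (p : ℝ≥0) (hp : p ≤ 1) : PMF Act :=
  PMF.ofFintype (fun a => match a with
    | .idle => ((1 - p : ℝ≥0) : ℝ≥0∞)
    | .new => p
    | .retx => 0) (by
      change ∑ a ∈ ({Act.idle, Act.new, Act.retx} : Finset Act), _ = _
      rw [Finset.sum_insert (by decide), Finset.sum_insert (by decide), Finset.sum_singleton,
        add_zero, ← ENNReal.coe_add, tsub_add_cancel_of_le hp, ENNReal.coe_one])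

theorem exists_policy_C_lt (M : Channel) {c : ℝ} (hc0 : 0 < c) (hc1 : c ≤ 1) :
    ∃ π : Policy M, π.J (startState M) < ⊤ ∧ π.C (startState M) < ENNReal.ofReal c := by
  -- The mean transmission cost per step is `p`, so half of `c` meets the strict bound while staying
  -- positive.
  set p : ℝ≥0 := Real.toNNReal (c / 2) with hp
  have hp0 : 0 < p := Real.toNNReal_pos.2 (by linarith)
  have hp1 : p ≤ 1 := Real.toNNReal_le_one.2 (by linarith)
  refine ⟨Policy.stationary (fun _ => bernoulliRule p hp1) ?_, ?_, ?_⟩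
  · rintro s a ha rfl
    exact absurd rfl ((PMF.mem_support_iff _ _).1 ha)
  · exact J_lt_top (mul_pos hp0 (one_sub_g_pos M)) (fun s => le_trans_start le_rfl) _
  · refine (avgCost_le_of_actMean_le (c := p) (fun s => ?_) _).trans_lt ?_
    · change ∑ a ∈ ({Act.idle, Act.new, Act.retx} : Finset Act), _ ≤ _
      rw [Finset.sum_insert (by decide), Finset.sum_insert (by decide), Finset.sum_singleton]
      simp [txCost, bernoulliRule]
    · exact (ENNReal.ofReal_lt_ofReal_iff hc0).2 (by linarith)

end bernoulli

theorem finite_cost_le (M : Channel) (b : ℝ) :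
    {s : State M | ∃ a : Act, Admissible s a ∧
      (ageCost s a : ℝ) + (txCost s a : ℝ) ≤ b}.Finite := by
  -- Since the attempt count is below the age, a bound on age confines both coordinates.
  refine Set.Finite.subset (((Set.finite_Iic ((⌊b⌋₊, ⌊b⌋₊) : ℕ × ℕ))).preimage
    Subtype.val_injective.injOn) ?_
  rintro (s : State M) ⟨a, -, h⟩
  have h1 : (s.age : ℝ) ≤ b := by
    have := (txCost s a).coe_nonneg
    simp only [ageCost, NNReal.coe_natCast] at h
    linarith
  have h2 : s.age ≤ ⌊b⌋₊ := Nat.le_floor h1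
  exact ⟨h2, s.2.1.le.trans h2⟩

end AoI

end

theorem mainTheorem5 (M : AoI.Channel) (Cmax : ℝ) (hC0 : 0 < Cmax) (hC1 : Cmax ≤ 1) :
    -- (i) cost sublevel sets are finite
    (∀ b : ℝ, 0 < b →
      {s : AoI.State M | ∃ a : AoI.Act, AoI.Admissible s a ∧
        (AoI.ageCost s a : ℝ) + (AoI.txCost s a : ℝ) ≤ b}.Finite) ∧
    -- (ii) a deterministic policy with one positive recurrent class, all other states transient
    (∃ f : AoI.DetPolicy M, ∃ R U : Set (AoI.State M),
      R ∪ U = Set.univ ∧ Disjoint R U ∧ f.IsPosRecurrentClass R ∧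
      (∀ s ∈ U, f.IsTransient s ∧ f.toPolicy ∈ AoI.passageClassStar s R) ∧
      (∀ s ∈ R, f.toPolicy.J s < ⊤ ∧ f.toPolicy.C s < ⊤)) ∧
    -- (iii) finite-cost passage between any two states
    (∀ s s' : AoI.State M, ∃ π : AoI.Policy M, π ∈ AoI.passageClassStar s {s'}) ∧
    -- (iv) uniqueness of the positive recurrent class of a deterministic policy
    (∀ f : AoI.DetPolicy M, (∃ s, f.PosRecurrent s) →
      ∃ R, f.IsPosRecurrentClass R ∧ AoI.startState M ∈ R ∧
        ∀ R', f.IsPosRecurrentClass R' → R' = R) ∧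
    -- (v) a policy with finite age and transmission cost below the constraint
    (∃ π : AoI.Policy M, π.J (AoI.startState M) < ⊤ ∧
      π.C (AoI.startState M) < ENNReal.ofReal Cmax) :=
  ⟨fun b _ => AoI.finite_cost_le M b, AoI.DetPolicy.exists_unichain M,
    AoI.exists_mem_passageClassStar, AoI.DetPolicy.existsUnique_isPosRecurrentClass,
    AoI.exists_policy_C_lt M hC0 hC1⟩
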